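/- **Tautology Theorem for $\mathcal Q^{\rm u}_0$.** $\mathcal Q^{\rm u}_0$ (Farmer) is the following version of Church's type theory with undefined terms. Types are $\imath$, $o$ and $(\alpha\beta)$ (functions from $\beta$ to $\alpha$). Wffs are built from variables (countably many of each type), the constants $\mathsf Q_{o\alpha\alpha}$, $\iota_{\alpha(o\alpha)}$ ($\alpha\neq o$) and arbitrary nonlogical constants by application $[\mathbf A_{\alpha\beta}\mathbf B_\beta]$ and abstraction $[\lambda\mathbf x_\beta\mathbf A_\alpha]$. Abbreviations: $[\mathbf A=\mathbf B]$ is $\mathsf Q\mathbf A\mathbf B$; $T_o$ is $\mathsf Q_{ooo}=\mathsf Q_{ooo}$; $F_o$ is $[\lambda x_oT_o]=[\lambda x_ox_o]$; $\forall\mathbf x_\alpha\mathbf A_o$ is $[\lambda y_\alpha T_o]=[\lambda\mathbf x_\alpha\mathbf A_o]$; $\wedge$ is $\lambda x_o\lambda y_o[[\lambda g_{ooo}[g_{ooo}T_oT_o]]=[\lambda g_{ooo}[g_{ooo}x_oy_o]]]$; $\supset$ is $\lambda x_o\lambda y_o[x_o=[x_o\wedge y_o]]$; ${\sim}$ is $\mathsf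 Q_{ooo}F_o$; $\vee$ is $\lambda x_o\lambda y_o\,{\sim}[{\sim}x_o\wedge{\sim}y_o]$; $\exists\mathbf x\mathbf A$ is ${\sim}\forall\mathbf x{\sim}\mathbf A$; $\exists_1\mathbf x_\alpha\mathbf A$ is $\exists y_\alpha[[\lambda\mathbf x_\alpha\mathbf A]=\mathsf Q y_\alpha]$ and $\mathbf A_\alpha{\downarrow}$ is $\exists x_\alpha[x_\alpha=\mathbf A_\alpha]$, where in each case the auxiliary variable is any variable of type $\alpha$ not occurring in $\mathbf A$ (schemas have an instance for every such choice); $\mathbf A{\uparrow}$ is ${\sim}[\mathbf A{\downarrow}]$; $\mathbf A\simeq\mathbf B$ is $[\mathbf A{\downarrow}\vee\mathbf B{\downarrow}]\supset[\mathbf A=\mathbf B]$; $\mathrm I\mathbf x_\alpha\mathbf A$ is $\iota_{\alpha(o\alpha)}[\lambda\mathbf x_\alpha\mathbf A]$. The axiom schemas are (A1) $[g_{oo}T_o\wedge g_{oo}F_o]=\forall x_o[g_{oo}x_o]$; (A2) $[x_\alpha=y_\alpha]\supset[h_{o\alpha}x_\alpha=h_{o\alpha}y_\alpha]$; (A3)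 $[f_{\alpha\beta}=g_{\alpha\beta}]=\forall x_\beta[f_{\alpha\beta}x_\beta\simeq g_{\alpha\beta}x_\beta]$; (A4) $\mathbf A_\alpha{\downarrow}\supset[[\lambda\mathbf x_\alpha\mathbf B_\beta]\mathbf A_\alpha\simeq\mathsf S^{\mathbf x_\alpha}_{\mathbf A_\alpha}\mathbf B_\beta]$ if $\mathbf A_\alpha$ is free for $\mathbf x_\alpha$ in $\mathbf B_\beta$, where $\mathsf S^{\mathbf x}_{\mathbf A}\mathbf B$ is the result of substituting $\mathbf A$ for the free occurrences of $\mathbf x$ in $\mathbf B$; (A5)–(A8) $\mathbf D{\downarrow}$ for $\mathbf D$ a variable, a primitive constant, an abstraction $[\lambda\mathbf x_\alpha\mathbf B_\beta]$, or an application $\mathbf A_{o\beta}\mathbf B_\beta$ of type $o$; (A9) $[\mathbf A_{o\beta}{\uparrow}\vee\mathbf B_\beta{\uparrow}]\supset{\sim}[\mathbf A_{o\beta}\mathbf B_\beta]$; (A10) $[\mathbf A_{\alpha\beta}{\uparrow}\vee\mathbf B_\beta{\uparrow}]\supset[\mathbf A_{\alpha\beta}\mathbf B_\beta]{\uparrow}$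 for $\alpha\ne o$; (A11) $\mathbf A_\alpha{\downarrow}\supset[\mathbf B_\alpha{\downarrow}\supset[[\mathbf A_\alpha\simeq\mathbf B_\alpha]\simeq[\mathbf A_\alpha=\mathbf B_\alpha]]]$; (A12) $\exists_1\mathbf x_\alpha\mathbf A_o\supset[[\mathrm I\mathbf x_\alpha\mathbf A_o]{\downarrow}\wedge\mathsf S^{\mathbf x_\alpha}_{\mathrm I\mathbf x_\alpha\mathbf A_o}\mathbf A_o]$ for $\alpha\ne o$, if $\mathrm I\mathbf x_\alpha\mathbf A_o$ is free for $\mathbf x_\alpha$ in $\mathbf A_o$; (A13) ${\sim}\exists_1\mathbf x_\alpha\mathbf A_o\supset[\mathrm I\mathbf x_\alpha\mathbf A_o]{\uparrow}$ for $\alpha\ne o$. The rules are (R1): from $\mathbf A_\alpha\simeq\mathbf B_\alpha$ and $\mathbf C_o$ infer the result of replacing one occurrence of $\mathbf A_\alpha$ in $\mathbf C_o$, not a variable immediately preceded by $\lambda$, by $\mathbf B_\alpha$; and (R2): from $\mathbf A_o$ and $\mathbf A_o\supset\mathbf B_o$ infer $\mathbf B_o$. A proof is a finite sequence of wffs of type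 $o$, each an instance of an axiom schema or inferred from preceding members by R1 or R2. For a set $\mathcal H$ of wffs of type $o$, $\mathcal H\vdash\mathbf A_o$ means that there are a proof $\mathcal S_1$ and a finite sequence $\mathcal S_2$ of wffs of type $o$ ending with $\mathbf A_o$ in which each member is in $\mathcal H$, or is a member of $\mathcal S_1$, or is inferred from preceding members of $\mathcal S_2$ by R2, or by R1 where the replaced occurrence does not lie in a part $\lambda\mathbf x_\beta\mathbf E_\gamma$ of $\mathbf C_o$ such that $\mathbf x_\beta$ is free both in a member of $\mathcal H$ and in $\mathbf A_\alpha\simeq\mathbf B_\alpha$. A wff of type $o$ is *tautologous* if it is a substitution instance of a tautology of classical propositional logic, that is, if it is obtained from a tautology built from propositional variables, $T_o$, $F_o$, ${\sim}$, $\wedge$, $\vee$, $\supset$, $\equiv$ by substituting wffs of type $o$ for the propositional variables, where $[\mathbf A_o\equiv\mathbf B_o]$ is $[\mathbf A_o=\mathbf B_o]$. **Theorem.** Let $\mathcal H$ be a set of wffs of type $o$ and $\mathbf B_o$ a wff of type $o$. 1. If $n\ge1$, $\mathcal H\vdash\mathbf A^1_o$, …, $\mathcal H\vdash\mathbf A^n_o$,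 and $[\mathbf A^1_o\wedge\cdots\wedge\mathbf A^n_o]\supset\mathbf B_o$ (conjunction associated to the left) is tautologous, then $\mathcal H\vdash\mathbf B_o$. 2. If $\mathbf B_o$ is tautologous, then $\mathcal H\vdash\mathbf B_o$. -/

import Mathlib

namespace Q0u

/-! ### Syntax -/

/-- Type symbols. `fn α β` is the type `(αβ)` of functions from `β` to `α`:
the type of values comes first and the type of arguments second. -/
inductive Ty : Type
  | ind : Ty
  | o : Ty
  | fn : Ty → Ty → Ty
  deriving DecidableEq

/-- Well-formed formulas of type `α`. For each type the variables are numbered by natural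
numbers, `var i α` being the `i`-th variable of type `α`. `C α` is the (unspecified) set of
nonlogical constants of type `α`. -/
inductive Wff.{u} (C : Ty → Type u) : Ty → Type u
  | var (i : ℕ) (α : Ty) : Wff C α
  | Q (α : Ty) : Wff C (.fn (.fn .o α) α)
  | iota (α : Ty) (h : α ≠ .o) : Wff C (.fn α (.fn .o α))
  | const {α : Ty} (c : C α) : Wff C α
  | app {α β : Ty} (A : Wff C (.fn α β)) (B : Wff C β) : Wff C α
  | lam (i : ℕ) (β : Ty) {α : Ty} (A : Wff C α) : Wff C (.fn α β)

universe u
variable {C : Ty → Type u}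

/- The variables of each type, in the order `f, g, h, x, y, z, f¹, g¹, …`. -/

/-- The index of the variable `f`. -/
abbrev vf : ℕ := 0
/-- The index of the variable `g`. -/
abbrev vg : ℕ := 1
/-- The index of the variable `h`. -/
abbrev vh : ℕ := 2
/-- The index of the variable `x`. -/
abbrev vx : ℕ := 3
/-- The index of the variable `y`. -/
abbrev vy : ℕ := 4

namespace Wff

/-- The primitive constants, logical and nonlogical. -/
inductive IsPrimConst : {α : Ty} → Wff C α → Prop
  | Q (α : Ty) : IsPrimConst (Wff.Q α)
  | iota (α : Ty) (h : α ≠ .o) : IsPrimConst (Wff.iota α h)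
  | const {α : Ty} (c : C α) : IsPrimConst (Wff.const c)

/-- The `i`-th variable of type `β` occurs (free, bound, or directly after a `λ`). -/
def Occurs (i : ℕ) (β : Ty) : {α : Ty} → Wff C α → Prop
  | _, var j γ => i = j ∧ β = γ
  | _, Q _ => False
  | _, iota _ _ => False
  | _, const _ => False
  | _, app A B => A.Occurs i β ∨ B.Occurs i β
  | _, lam j γ A => (i = j ∧ β = γ) ∨ A.Occurs i β

/-- The `i`-th variable of type `β` has a free occurrence. -/
def Free (i : ℕ) (β : Ty) : {α : Ty} → Wff C α → Prop
  | _, var j γ => i = j ∧ β = γ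
  | _, Q _ => False
  | _, iota _ _ => False
  | _, const _ => False
  | _, app A B => A.Free i β ∨ B.Free i β
  | _, lam j γ A => ¬ (i = j ∧ β = γ) ∧ A.Free i β

/-- `subst i β A B` is the result of replacing each free occurrence in `B` of the `i`-th
variable of type `β` by `A`. -/
def subst (i : ℕ) (β : Ty) (A : Wff C β) : {α : Ty} → Wff C α → Wff C α
  | _, var j γ => if h : i = j ∧ β = γ then h.2 ▸ A else var j γ
  | _, Q α => Q α
  | _, iota α h => iota α h
  | _, const c => const c
  | _, app B D => app (subst i β A B) (subst i β A D)
  | _, lam j γ B => if i = j ∧ β = γ then lam j γ B else lam j γ (subst i β A B)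

/-- `A` is free for the `i`-th variable of type `β` in `B`: no free occurrence of that variable
in `B` lies in a part `λ y D` of `B` with `y` free in `A`. -/
def FreeFor (i : ℕ) (β : Ty) (A : Wff C β) : {α : Ty} → Wff C α → Prop
  | _, var _ _ => True
  | _, Q _ => True
  | _, iota _ _ => True
  | _, const _ => True
  | _, app B D => FreeFor i β A B ∧ FreeFor i β A D
  | _, lam j γ B => (lam j γ B).Free i β → ¬ A.Free j γ ∧ FreeFor i β A B

/-! ### Defined constants and abbreviations -/

/-- `[A = B]` -/
def eq {α : Ty} (A B : Wff C α) : Wff C .o := app (app (Q α) A) B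

/-- The wff `T_o`. -/
def tru : Wff C .o := eq (Q .o) (Q .o)

/-- The wff `F_o`. -/
def fls : Wff C .o := eq (lam vx .o tru) (lam vx .o (var vx .o))

/-- `[∀ x A]`, where `x` is the `i`-th variable of type `α`. -/
def all (i : ℕ) (α : Ty) (A : Wff C .o) : Wff C .o :=
  eq (lam vy α tru) (lam i α A)

/-- The constant `∧_{ooo}`. -/
def andC : Wff C (.fn (.fn .o .o) .o) :=
  lam vx .o (lam vy .o (eq
    (lam vg (.fn (.fn .o .o) .o) (app (app (var vg (.fn (.fn .o .o) .o)) tru) tru))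
    (lam vg (.fn (.fn .o .o) .o)
      (app (app (var vg (.fn (.fn .o .o) .o)) (var vx .o)) (var vy .o)))))

/-- `[A ∧ B]` -/
def and (A B : Wff C .o) : Wff C .o := app (app andC A) B

/-- The constant `⊃_{ooo}`. -/
def impC : Wff C (.fn (.fn .o .o) .o) :=
  lam vx .o (lam vy .o (eq (var vx .o) (and (var vx .o) (var vy .o))))

/-- `[A ⊃ B]` -/
def imp (A B : Wff C .o) : Wff C .o := app (app impC A) B

/-- The constant `∼_{oo}`. -/
def notC : Wff C (.fn .o .o) := app (Q .o) fls

/-- `[∼A]` -/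
def not (A : Wff C .o) : Wff C .o := app notC A

/-- The constant `∨_{ooo}`. -/
def orC : Wff C (.fn (.fn .o .o) .o) :=
  lam vx .o (lam vy .o (not (and (not (var vx .o)) (not (var vy .o)))))

/-- `[A ∨ B]` -/
def or (A B : Wff C .o) : Wff C .o := app (app orC A) B

/-- `[∃ x A]`, where `x` is the `i`-th variable of type `α`. -/
def ex (i : ℕ) (α : Ty) (A : Wff C .o) : Wff C .o := not (all i α (not A))

/-- `[I x A]`, the definite description of the `i`-th variable `x` of type `α ≠ o`. -/
def desc (i : ℕ) (α : Ty) (h : α ≠ .o) (A : Wff C .o) : Wff C α :=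
  app (iota α h) (lam i α A)

/- The abbreviations `∃₁ x A`, `A↓`, `A↑` and `A ≃ B` involve an auxiliary bound variable that
is only required not to occur in the wffs at hand. They are therefore read as schemas: the
predicates below say that a wff is one of the wffs that the abbreviation may stand for. -/

/-- `D` is `[∃₁ x A]`, with `x` the `i`-th variable of type `α`: it is the wff
`[∃ y [[λ x A] = Q y]]` for some variable `y` of type `α` that does not occur in `A`. -/
def IsExUnique (i : ℕ) (α : Ty) (A D : Wff C .o) : Prop :=
  ∃ j : ℕ, ¬ A.Occurs j α ∧ D = ex j α (eq (lam i α A) (app (Q α) (var j α)))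

/-- `D` is `A↓`: it is `[∃ x [x = A]]` for some variable `x` that does not occur in `A`. -/
def IsDef {α : Ty} (A : Wff C α) (D : Wff C .o) : Prop :=
  ∃ j : ℕ, ¬ A.Occurs j α ∧ D = ex j α (eq (var j α) A)

/-- `D` is `A↑`, that is `[∼ A↓]`. -/
def IsUndef {α : Ty} (A : Wff C α) (D : Wff C .o) : Prop :=
  ∃ E, IsDef A E ∧ D = not E

/-- `D` is `[A ≃ B]`, that is `[A↓ ∨ B↓] ⊃ [A = B]`. -/
def IsQEq {α : Ty} (A B : Wff C α) (D : Wff C .o) : Prop :=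
  ∃ E G, IsDef A E ∧ IsDef B G ∧ D = imp (or E G) (eq A B)

end Wff

open Wff

/-! ### The proof system -/

/-- `AxInst D`: the wff `D` is an instance of one of the thirteen schemas `A1` to `A13`. -/
inductive AxInst : Wff C .o → Prop
  | A1 : AxInst
      (eq (and (app (var vg (.fn .o .o)) tru) (app (var vg (.fn .o .o)) fls))
        (all vx .o (app (var vg (.fn .o .o)) (var vx .o))))
  | A2 (α : Ty) : AxInst
      (imp (eq (var vx α) (var vy α))
        (eq (app (var vh (.fn .o α)) (var vx α)) (app (var vh (.fn .o α)) (var vy α))))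
  | A3 (α β : Ty) {E : Wff C .o}
      (hE : IsQEq (app (var vf (.fn α β)) (var vx β)) (app (var vg (.fn α β)) (var vx β)) E) :
      AxInst (eq (eq (var vf (.fn α β)) (var vg (.fn α β))) (all vx β E))
  | A4 {α β : Ty} (i : ℕ) (A : Wff C α) (B : Wff C β) {D E : Wff C .o}
      (hfree : FreeFor i α A B) (hD : IsDef A D)
      (hE : IsQEq (app (lam i α B) A) (subst i α A B) E) : AxInst (imp D E)
  | A5 (i : ℕ) (α : Ty) {D : Wff C .o} (hD : IsDef (var i α) D) : AxInst D
  | A6 {α : Ty} (c : Wff C α) {D : Wff C .o} (hc : IsPrimConst c) (hD : IsDef c D) : AxInst D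
  | A7 {β : Ty} (i : ℕ) (α : Ty) (B : Wff C β) {D : Wff C .o} (hD : IsDef (lam i α B) D) :
      AxInst D
  | A8 {β : Ty} (A : Wff C (.fn .o β)) (B : Wff C β) {D : Wff C .o}
      (hD : IsDef (app A B) D) : AxInst D
  | A9 {β : Ty} (A : Wff C (.fn .o β)) (B : Wff C β) {D E : Wff C .o}
      (hD : IsUndef A D) (hE : IsUndef B E) : AxInst (imp (or D E) (not (app A B)))
  | A10 {α β : Ty} (hα : α ≠ .o) (A : Wff C (.fn α β)) (B : Wff C β) {D E G : Wff C .o}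
      (hD : IsUndef A D) (hE : IsUndef B E) (hG : IsUndef (app A B) G) :
      AxInst (imp (or D E) G)
  | A11 {α : Ty} (A B : Wff C α) {D E G K : Wff C .o}
      (hD : IsDef A D) (hE : IsDef B E) (hG : IsQEq A B G) (hK : IsQEq G (eq A B) K) :
      AxInst (imp D (imp E K))
  | A12 {α : Ty} (hα : α ≠ .o) (i : ℕ) (A : Wff C .o) {D E : Wff C .o}
      (hfree : FreeFor i α (desc i α hα A) A)
      (hD : IsExUnique i α A D) (hE : IsDef (desc i α hα A) E) :
      AxInst (imp D (and E (subst i α (desc i α hα A) A)))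
  | A13 {α : Ty} (hα : α ≠ .o) (i : ℕ) (A : Wff C .o) {D E : Wff C .o}
      (hD : IsExUnique i α A D) (hE : IsUndef (desc i α hα A) E) :
      AxInst (imp (not D) E)

/-- `Repl ok A B K L`: `L` is the result of replacing one occurrence of `A` in `K` by an
occurrence of `B`, where every variable `x` such that the replaced occurrence lies in a part
`λ x E` of `K` satisfies `ok`. A variable directly after a `λ` is not a part of `K` that can be
replaced. -/
inductive Repl (ok : ℕ → Ty → Prop) {α : Ty} (A B : Wff C α) :
    {γ : Ty} → Wff C γ → Wff C γ → Prop
  | here : Repl ok A B A B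
  | appFun {γ δ : Ty} {K L : Wff C (.fn γ δ)} (M : Wff C δ) (h : Repl ok A B K L) :
      Repl ok A B (app K M) (app L M)
  | appArg {γ δ : Ty} (M : Wff C (.fn γ δ)) {K L : Wff C δ} (h : Repl ok A B K L) :
      Repl ok A B (app M K) (app M L)
  | lamBody {γ : Ty} (i : ℕ) (δ : Ty) {K L : Wff C γ} (hi : ok i δ) (h : Repl ok A B K L) :
      Repl ok A B (lam i δ K) (lam i δ L)

/-- Rule `R1` (quasi-equality substitution): `D` follows from `E`, which is of the form
`[A ≃ B]`, and `K`. -/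
def R1 (E K D : Wff C .o) : Prop :=
  ∃ (α : Ty) (A B : Wff C α), IsQEq A B E ∧ Repl (fun _ _ => True) A B K D

/-- Rule `R1` as restricted in proofs from `H`: the replaced occurrence must not lie in a part
`λ x G` of `K` with `x` free both in a member of `H` and in `[A ≃ B]`. -/
def R1From (H : Set (Wff C .o)) (E K D : Wff C .o) : Prop :=
  ∃ (α : Ty) (A B : Wff C α), IsQEq A B E ∧
    Repl (fun i δ => ¬ ((∃ G ∈ H, G.Free i δ) ∧ E.Free i δ)) A B K D

/-- Rule `R2` (modus ponens): `D` follows from `A` and `E`, which is `[A ⊃ D]`. -/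
def R2 (A E D : Wff C .o) : Prop := E = imp A D

/-- `S` is a proof of `A`: a finite sequence ending with `A` in which each member is an instance
of a schema or is inferred from preceding members by `R1` or `R2`. -/
def IsProof (S : List (Wff C .o)) (A : Wff C .o) : Prop :=
  S.getLast? = some A ∧
  ∀ (P : List (Wff C .o)) (D : Wff C .o) (R : List (Wff C .o)), S = P ++ D :: R →
    AxInst D ∨ (∃ E ∈ P, ∃ K ∈ P, R1 E K D) ∨ (∃ K ∈ P, ∃ E ∈ P, R2 K E D)

/-- The sequences `S₁` and `S₂` form a proof of `A` from `H`. -/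
def IsProofFrom (H : Set (Wff C .o)) (S₁ S₂ : List (Wff C .o)) (A : Wff C .o) : Prop :=
  (∃ B, IsProof S₁ B) ∧
  S₂.getLast? = some A ∧
  ∀ (P : List (Wff C .o)) (D : Wff C .o) (R : List (Wff C .o)), S₂ = P ++ D :: R →
    D ∈ H ∨ D ∈ S₁ ∨ (∃ E ∈ P, ∃ K ∈ P, R1From H E K D) ∨ (∃ K ∈ P, ∃ E ∈ P, R2 K E D)

/-- `H ⊢ A` -/
def Proves (H : Set (Wff C .o)) (A : Wff C .o) : Prop :=
  ∃ S₁ S₂ : List (Wff C .o), IsProofFrom H S₁ S₂ A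

/-! ### Tautologies -/

/-- Formulas of classical propositional logic, with countably many propositional variables. -/
inductive PropForm : Type
  | atom (n : ℕ) : PropForm
  | tru : PropForm
  | fls : PropForm
  | neg (p : PropForm) : PropForm
  | conj (p q : PropForm) : PropForm
  | disj (p q : PropForm) : PropForm
  | imp (p q : PropForm) : PropForm
  | iff (p q : PropForm) : PropForm

namespace PropForm

/-- The truth value under a truth assignment. -/
def eval (v : ℕ → Bool) : PropForm → Bool
  | atom n => v n
  | tru => true
  | fls => false
  | neg p => !(p.eval v)
  | conj p q => p.eval v && q.eval v
  | disj p q => p.eval v || q.eval v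
  | imp p q => !(p.eval v) || q.eval v
  | iff p q => p.eval v == q.eval v

/-- A tautology is true under every truth assignment. -/
def IsTautology (p : PropForm) : Prop := ∀ v, p.eval v = true

/-- The wff obtained by substituting the wffs `σ n` for the propositional variables;
a biconditional is an equation between wffs of type `o`. -/
def inst (σ : ℕ → Wff C .o) : PropForm → Wff C .o
  | atom n => σ n
  | tru => Wff.tru
  | fls => Wff.fls
  | neg p => Wff.not (p.inst σ)
  | conj p q => Wff.and (p.inst σ) (q.inst σ)
  | disj p q => Wff.or (p.inst σ) (q.inst σ)
  | imp p q => Wff.imp (p.inst σ) (q.inst σ)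
  | iff p q => Wff.eq (p.inst σ) (q.inst σ)

end PropForm

/-- A wff of type `o` is tautologous if it is a substitution instance of a tautology. -/
def Tautologous (B : Wff C .o) : Prop :=
  ∃ (p : PropForm) (σ : ℕ → Wff C .o), p.IsTautology ∧ B = p.inst σ

/-- `A⁰ ∧ ⋯ ∧ Aⁿ`, associated to the left. -/
def bigAnd : (n : ℕ) → (Fin (n + 1) → Wff C .o) → Wff C .o
  | 0, A => A 0
  | n + 1, A => Wff.and (bigAnd n fun k => A k.castSucc) (A (Fin.last (n + 1)))

end Q0u

/-! Every tautologous wff is a theorem without hypotheses, and everything else follows by modus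
ponens. Since `A ⊃ (B ⊃ A ∧ B)` is itself tautologous, a conjunction of consequences of `H` is a
consequence of `H`. So inside a derivation from `H` only R2 is applied, and the variable restriction
on R1 never matters.

The calculus is driven by provable quasi-equality `QE`. A vacuous β-step (A4) and R1 make it
reflexive; R1 then makes it a congruence, even under `λ`. By A11 it may be exchanged with `=`
between defined wffs, and wffs of type `o` are always defined, so undefinedness never enters the
propositional part.

Extensionality (A3) gives η and `[A = A] ≃ T` for defined `A`. Then A1, which says that a predicate
true of `T` and of `F` is true everywhere, becomes proof by cases (`QE.cases_tru`). It reduces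
propositional laws to values at `T` and `F`: `T ∧ A ≃ A` and `[T = A] ≃ A`, the latter making
theoremhood the same as being quasi-equal to `T`. The rows beginning with `F` come from Leibniz's
law (A2).

With the truth tables known, a tautology whose atoms are all `T` or `F` evaluates to `T`; proof by
cases then replaces these constants by arbitrary wffs, one atom at a time. -/

namespace Q0u

open Wff

universe u
variable {C : Ty → Type u}

/-! ### Derivability without hypotheses -/

/-- Theorems: the wffs derivable from the axiom schemas by `R1` and `R2`. -/
inductive Thm : Wff C .o → Prop
  | ax {D : Wff C .o} (h : AxInst D) : Thm D
  | r1 {E K D : Wff C .o} (h : R1 E K D) (hE : Thm E) (hK : Thm K) : Thm D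
  | r2 {A D : Wff C .o} (hA : Thm A) (hE : Thm (imp A D)) : Thm D

/-- Each member of `S` is related by `Φ` to the list of its predecessors. -/
def Justified {X : Type*} (Φ : List X → X → Prop) (S : List X) : Prop :=
  ∀ (P : List X) (D : X) (R : List X), S = P ++ D :: R → Φ P D

theorem Justified.append {X : Type*} {Φ : List X → X → Prop}
    (mono : ∀ P Q D, Φ P D → Φ (Q ++ P) D) {S S' : List X}
    (h : Justified Φ S) (h' : Justified Φ S') : Justified Φ (S ++ S') := by
  intro P D R e
  rcases List.append_eq_append_iff.1 e with ⟨L, rfl, e2⟩ | ⟨L, rfl, e2⟩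
  · exact mono _ _ _ (h' _ _ _ e2)
  · cases L with
    | nil =>
      have := mono [] P D (h' [] D R (by simpa using e2.symm))
      simpa using this
    | cons a L =>
      simp only [List.cons_append, List.cons.injEq] at e2
      obtain ⟨rfl, -⟩ := e2
      exact h _ _ _ rfl

theorem Justified.concat {X : Type*} {Φ : List X → X → Prop} {S : List X} {D : X}
    (h : Justified Φ S) (hD : Φ S D) : Justified Φ (S ++ [D]) := by
  intro P E R e
  rcases List.eq_nil_or_concat R with rfl | ⟨R', b, rfl⟩
  · obtain ⟨rfl, e2⟩ := List.append_inj' e rfl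
    cases e2
    exact hD
  · have e3 : S ++ [D] = (P ++ E :: R') ++ [b] := by simpa using e
    exact h _ _ _ (List.append_inj' e3 rfl).1

/-- The condition on the members of a proof. -/
def ProofStep (P : List (Wff C .o)) (D : Wff C .o) : Prop :=
  AxInst D ∨ (∃ E ∈ P, ∃ K ∈ P, R1 E K D) ∨ (∃ K ∈ P, ∃ E ∈ P, R2 K E D)

theorem ProofStep.append_left (P Q : List (Wff C .o)) (D : Wff C .o) (h : ProofStep P D) :
    ProofStep (Q ++ P) D := by
  rcases h with h | ⟨E, hE, K, hK, h⟩ | ⟨E, hE, K, hK, h⟩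
  · exact .inl h
  · exact .inr (.inl ⟨E, by simp [hE], K, by simp [hK], h⟩)
  · exact .inr (.inr ⟨E, by simp [hE], K, by simp [hK], h⟩)

theorem IsProof.append {S S' : List (Wff C .o)} {A A' : Wff C .o} (h : IsProof S A)
    (h' : IsProof S' A') : IsProof (S ++ S') A' :=
  ⟨by simp [List.getLast?_append, h'.1], Justified.append ProofStep.append_left h.2 h'.2⟩

theorem IsProof.mem {S : List (Wff C .o)} {A : Wff C .o} (h : IsProof S A) : A ∈ S :=
  List.mem_of_getLast? h.1

theorem Thm.exists_isProof {A : Wff C .o} (h : Thm A) : ∃ S, IsProof S A := by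
  induction h with
  | @ax D h =>
    refine ⟨[] ++ [D], by simp, Justified.concat (Φ := ProofStep) ?_ (.inl h)⟩
    intro P D R e
    simp at e
  | @r1 E K D h _ _ hE hK =>
    obtain ⟨S, hS⟩ := hE
    obtain ⟨S', hS'⟩ := hK
    exact ⟨S ++ S' ++ [D], by simp, Justified.concat (Φ := ProofStep) (hS.append hS').2
      (.inr (.inl ⟨E, by simp [hS.mem], K, by simp [hS'.mem], h⟩))⟩
  | @r2 E D _ _ hE hK =>
    obtain ⟨S, hS⟩ := hE
    obtain ⟨S', hS'⟩ := hK
    exact ⟨S ++ S' ++ [D], by simp, Justified.concat (Φ := ProofStep) (hS.append hS').2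
      (.inr (.inr ⟨E, by simp [hS.mem], _, by simp [hS'.mem], rfl⟩))⟩

/-- The condition on the members of the second sequence of a proof from hypotheses. -/
def ProofFromStep (H : Set (Wff C .o)) (S₁ P : List (Wff C .o)) (D : Wff C .o) : Prop :=
  D ∈ H ∨ D ∈ S₁ ∨ (∃ E ∈ P, ∃ K ∈ P, R1From H E K D) ∨ (∃ K ∈ P, ∃ E ∈ P, R2 K E D)

theorem ProofFromStep.append_left (H : Set (Wff C .o)) (S₁ P Q : List (Wff C .o))
    (D : Wff C .o) (h : ProofFromStep H S₁ P D) : ProofFromStep H S₁ (Q ++ P) D := by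
  rcases h with h | h | ⟨E, hE, K, hK, h⟩ | ⟨E, hE, K, hK, h⟩
  · exact .inl h
  · exact .inr (.inl h)
  · exact .inr (.inr (.inl ⟨E, by simp [hE], K, by simp [hK], h⟩))
  · exact .inr (.inr (.inr ⟨E, by simp [hE], K, by simp [hK], h⟩))

theorem ProofFromStep.mono {H : Set (Wff C .o)} {S₁ S₂ P : List (Wff C .o)} {D : Wff C .o}
    (hS : S₁ ⊆ S₂) (h : ProofFromStep H S₁ P D) : ProofFromStep H S₂ P D :=
  h.imp_right (Or.imp_left fun h => hS h)

theorem Thm.proves {A : Wff C .o} (h : Thm A) (H : Set (Wff C .o)) : Proves H A := by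
  obtain ⟨S, hS⟩ := h.exists_isProof
  refine ⟨S, [] ++ [A], ⟨A, hS⟩, by simp,
    Justified.concat (Φ := ProofFromStep H S) ?_ (.inr (.inl hS.mem))⟩
  intro P D R e
  simp at e

/-- R2 carries no side condition on the free variables of `H`, so the two derivations can simply be
concatenated. -/
theorem Proves.mp {H : Set (Wff C .o)} {A B : Wff C .o} (h : Proves H A)
    (h' : Proves H (imp A B)) : Proves H B := by
  obtain ⟨S₁, S₂, ⟨E, hE⟩, hl, hS⟩ := h
  obtain ⟨S₁', S₂', ⟨E', hE'⟩, hl', hS'⟩ := h'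
  refine ⟨S₁ ++ S₁', S₂ ++ S₂' ++ [B], ⟨E', hE.append hE'⟩, by simp,
    Justified.concat (Φ := ProofFromStep H (S₁ ++ S₁')) ?_ ?_⟩
  · refine Justified.append (ProofFromStep.append_left _ _) ?_ ?_
    · exact fun P D R e => ProofFromStep.mono (by simp) (hS P D R e)
    · exact fun P D R e => ProofFromStep.mono (by simp) (hS' P D R e)
  · exact .inr (.inr (.inr ⟨A, by simp [List.mem_of_getLast? hl], _,
      by simp [List.mem_of_getLast? hl'], rfl⟩))

/-! ### Fresh variables and substitution -/

/-- A bound beyond which all indices are fresh, rather than one fresh index, lets several wffs share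
a fresh variable by taking a maximum. -/
theorem Wff.exists_forall_not_occurs {α : Ty} (A : Wff C α) :
    ∃ N, ∀ j, N ≤ j → ∀ β, ¬ A.Occurs j β := by
  induction A with
  | var i α => exact ⟨i + 1, fun j hj β h => by have := h.1; omega⟩
  | Q α => exact ⟨0, fun j hj β h => h⟩
  | iota α h => exact ⟨0, fun j hj β h => h⟩
  | const c => exact ⟨0, fun j hj β h => h⟩
  | app A B hA hB =>
    obtain ⟨N, hN⟩ := hA
    obtain ⟨M, hM⟩ := hB
    exact ⟨max N M, fun j hj β h => h.elim (hN j (le_trans (le_max_left _ _) hj) β)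
      (hM j (le_trans (le_max_right _ _) hj) β)⟩
  | lam i β A hA =>
    obtain ⟨N, hN⟩ := hA
    refine ⟨max N (i + 1), fun j hj β h => h.elim (fun h => ?_)
      (hN j (le_trans (le_max_left _ _) hj) β)⟩
    have := h.1
    have := le_trans (le_max_right _ _) hj
    omega

theorem Wff.Free.occurs {i : ℕ} {β α : Ty} {A : Wff C α} (h : A.Free i β) : A.Occurs i β := by
  induction A with
  | var => exact h
  | Q => exact h
  | iota => exact h
  | const => exact h
  | app A B hA hB => exact h.imp hA hB
  | lam j γ A hA => exact .inr (hA h.2)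

theorem Wff.subst_of_not_free {i : ℕ} {β α : Ty} {A : Wff C β} {B : Wff C α}
    (h : ¬ B.Free i β) : subst i β A B = B := by
  induction B with
  | var j γ => exact dif_neg h
  | Q => rfl
  | iota => rfl
  | const => rfl
  | app D E hD hE =>
    simp only [Free, not_or] at h
    simp [subst, hD h.1, hE h.2]
  | lam j γ D hD =>
    by_cases hc : i = j ∧ β = γ
    · exact if_pos hc
    · simp [subst, hD fun h' => h ⟨hc, h'⟩]

theorem Wff.freeFor_of_not_free {i : ℕ} {β α : Ty} {A : Wff C β} {B : Wff C α}
    (h : ¬ B.Free i β) : FreeFor i β A B := by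
  induction B with
  | var => trivial
  | Q => trivial
  | iota => trivial
  | const => trivial
  | app D E hD hE =>
    simp only [Free, not_or] at h
    exact ⟨hD h.1, hE h.2⟩
  | lam j γ D hD => exact fun h' => absurd h' h

/-- `A` has no free variables. -/
def Wff.Closed {α : Ty} (A : Wff C α) : Prop := ∀ i β, ¬ A.Free i β

theorem Wff.Closed.freeFor {i : ℕ} {β α : Ty} {A : Wff C β} (hA : A.Closed) (B : Wff C α) :
    FreeFor i β A B := by
  induction B with
  | var => trivial
  | Q => trivial
  | iota => trivial
  | const => trivial
  | app D E hD hE => exact ⟨hD, hE⟩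
  | lam j γ D hD => exact fun _ => ⟨hA _ _, hD⟩

@[simp] theorem Wff.subst_var_self (i : ℕ) (β : Ty) (A : Wff C β) :
    subst i β A (var i β) = A := by
  simp [subst]

@[simp] theorem Wff.subst_app (i : ℕ) {α β γ : Ty} (A : Wff C β) (B : Wff C (.fn α γ))
    (D : Wff C γ) : subst i β A (app B D) = app (subst i β A B) (subst i β A D) := rfl

@[simp] theorem Wff.subst_eq (i : ℕ) {α β : Ty} (A : Wff C β) (B D : Wff C α) :
    subst i β A (eq B D) = eq (subst i β A B) (subst i β A D) := rfl

@[simp] theorem Wff.freeFor_app (i : ℕ) {α β γ : Ty} (A : Wff C β) (B : Wff C (.fn α γ))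
    (D : Wff C γ) : FreeFor i β A (app B D) ↔ FreeFor i β A B ∧ FreeFor i β A D := Iff.rfl

@[simp] theorem Wff.freeFor_eq (i : ℕ) {α β : Ty} (A : Wff C β) (B D : Wff C α) :
    FreeFor i β A (eq B D) ↔ FreeFor i β A B ∧ FreeFor i β A D := by
  simp [eq, FreeFor]

theorem Wff.closed_tru : (tru : Wff C .o).Closed := by
  simp [Closed, tru, eq, Free]

theorem Wff.closed_fls : (fls : Wff C .o).Closed := by
  simp +contextual [Closed, fls, tru, eq, Free]

theorem Wff.closed_andC : (andC : Wff C _).Closed := by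
  simp +contextual [Closed, andC, tru, eq, Free]

theorem Wff.closed_notC : (notC : Wff C _).Closed := by
  simp [Closed, notC, Free]
  exact closed_fls

theorem Wff.closed_impC : (impC : Wff C _).Closed := by
  simp +contextual [Closed, impC, and, eq, Free, closed_andC _ _]

theorem Wff.closed_orC : (orC : Wff C _).Closed := by
  simp +contextual [Closed, orC, and, not, Free, closed_andC _ _, closed_notC _ _]

@[simp] theorem Wff.subst_tru (i : ℕ) {β : Ty} (A : Wff C β) : subst i β A tru = tru :=
  subst_of_not_free (closed_tru _ _)

@[simp] theorem Wff.subst_fls (i : ℕ) {β : Ty} (A : Wff C β) : subst i β A fls = fls :=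
  subst_of_not_free (closed_fls _ _)

@[simp] theorem Wff.subst_and (i : ℕ) {β : Ty} (A : Wff C β) (B D : Wff C .o) :
    subst i β A (and B D) = and (subst i β A B) (subst i β A D) := by
  simp [and, subst_of_not_free (closed_andC i β)]

@[simp] theorem Wff.subst_imp (i : ℕ) {β : Ty} (A : Wff C β) (B D : Wff C .o) :
    subst i β A (imp B D) = imp (subst i β A B) (subst i β A D) := by
  simp [imp, subst_of_not_free (closed_impC i β)]

@[simp] theorem Wff.subst_or (i : ℕ) {β : Ty} (A : Wff C β) (B D : Wff C .o) :
    subst i β A (or B D) = or (subst i β A B) (subst i β A D) := by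
  simp [or, subst_of_not_free (closed_orC i β)]

@[simp] theorem Wff.subst_not (i : ℕ) {β : Ty} (A : Wff C β) (B : Wff C .o) :
    subst i β A (not B) = not (subst i β A B) := by
  simp [not, subst_of_not_free (closed_notC i β)]

@[simp] theorem Wff.freeFor_tru (i : ℕ) {β : Ty} (A : Wff C β) : FreeFor i β A tru :=
  freeFor_of_not_free (closed_tru _ _)

@[simp] theorem Wff.freeFor_fls (i : ℕ) {β : Ty} (A : Wff C β) : FreeFor i β A fls :=
  freeFor_of_not_free (closed_fls _ _)

@[simp] theorem Wff.freeFor_and (i : ℕ) {β : Ty} (A : Wff C β) (B D : Wff C .o) :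
    FreeFor i β A (and B D) ↔ FreeFor i β A B ∧ FreeFor i β A D := by
  simp [and, freeFor_of_not_free (closed_andC i β)]

@[simp] theorem Wff.freeFor_imp (i : ℕ) {β : Ty} (A : Wff C β) (B D : Wff C .o) :
    FreeFor i β A (imp B D) ↔ FreeFor i β A B ∧ FreeFor i β A D := by
  simp [imp, freeFor_of_not_free (closed_impC i β)]

@[simp] theorem Wff.freeFor_or (i : ℕ) {β : Ty} (A : Wff C β) (B D : Wff C .o) :
    FreeFor i β A (or B D) ↔ FreeFor i β A B ∧ FreeFor i β A D := by
  simp [or, freeFor_of_not_free (closed_orC i β)]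

@[simp] theorem Wff.freeFor_not (i : ℕ) {β : Ty} (A : Wff C β) (B : Wff C .o) :
    FreeFor i β A (not B) ↔ FreeFor i β A B := by
  simp [not, freeFor_of_not_free (closed_notC i β)]

theorem Wff.freeFor_lam {i j : ℕ} {α β γ : Ty} {A : Wff C β} {B : Wff C α}
    (hA : ¬ A.Free j γ) (hB : FreeFor i β A B) : FreeFor i β A (lam j γ B) :=
  fun _ => ⟨hA, hB⟩

@[simp] theorem Wff.freeFor_lam_tru (i j : ℕ) {β γ : Ty} (A : Wff C β) :
    FreeFor i β A (lam j γ tru : Wff C _) :=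
  freeFor_of_not_free fun h => closed_tru _ _ h.2

@[simp] theorem Wff.freeFor_var (i j : ℕ) {β γ : Ty} (A : Wff C β) :
    FreeFor i β A (var j γ) := trivial

/-! ### Provable quasi-equality -/

/-- `⊢ A↓` for some choice of the auxiliary variable. -/
def Dfd {α : Ty} (A : Wff C α) : Prop := ∃ D, IsDef A D ∧ Thm D

/-- `⊢ A ≃ B` for some choice of the auxiliary variables. -/
def QE {α : Ty} (A B : Wff C α) : Prop := ∃ E, IsQEq A B E ∧ Thm E

/-- `A ≃ B` with the `j`-th variable as both auxiliary variables. -/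
def qeq (j : ℕ) {α : Ty} (A B : Wff C α) : Wff C .o :=
  imp (or (ex j α (eq (var j α) A)) (ex j α (eq (var j α) B))) (eq A B)

theorem isQEq_qeq {j : ℕ} {α : Ty} {A B : Wff C α} (hA : ¬ A.Occurs j α)
    (hB : ¬ B.Occurs j α) : IsQEq A B (qeq j A B) :=
  ⟨_, _, ⟨j, hA, rfl⟩, ⟨j, hB, rfl⟩, rfl⟩

theorem dfd_var (i : ℕ) (α : Ty) : Dfd (var i α : Wff C α) := by
  have h : IsDef (var i α : Wff C α) _ := ⟨i + 1, by simp [Occurs], rfl⟩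
  exact ⟨_, h, .ax (.A5 i α h)⟩

theorem exists_isDef {α : Ty} (A : Wff C α) : ∃ D, IsDef A D :=
  have ⟨N, hN⟩ := A.exists_forall_not_occurs
  ⟨_, N, hN N le_rfl α, rfl⟩

theorem exists_isQEq {α : Ty} (A B : Wff C α) : ∃ D, IsQEq A B D :=
  have ⟨_, hD⟩ := exists_isDef A
  have ⟨_, hE⟩ := exists_isDef B
  ⟨_, _, _, hD, hE, rfl⟩

theorem dfd_lam (i : ℕ) (α : Ty) {β : Ty} (B : Wff C β) : Dfd (lam i α B) :=
  have ⟨D, h⟩ := exists_isDef (lam i α B)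
  ⟨D, h, .ax (.A7 i α B h)⟩

theorem dfd_Q (α : Ty) : Dfd (Q α : Wff C _) :=
  have ⟨D, h⟩ := exists_isDef (Q α : Wff C _)
  ⟨D, h, .ax (.A6 _ (.Q α) h)⟩

/-- Only variables, nonlogical constants and applications can have type `o`; the other constructors
produce functions. A5, A6 and A8 cover these three. -/
theorem dfd_o (A : Wff C .o) : Dfd A := by
  obtain ⟨D, h⟩ := exists_isDef A
  refine ⟨D, h, .ax ?_⟩
  cases A with
  | var i => exact .A5 i .o h
  | const c => exact .A6 _ (.const c) h
  | app A B => exact .A8 A B h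

theorem beta_thm {i : ℕ} {α β : Ty} {A : Wff C α} {B : Wff C β} (hA : Dfd A)
    (hf : FreeFor i α A B) {E : Wff C .o}
    (hE : IsQEq (app (lam i α B) A) (subst i α A B) E) : Thm E :=
  have ⟨_, hD, h⟩ := hA
  .r2 h (.ax (.A4 i A B hf hD hE))

theorem QE.beta {i : ℕ} {α β : Ty} {A : Wff C α} {B : Wff C β} (hA : Dfd A)
    (hf : FreeFor i α A B) : QE (app (lam i α B) A) (subst i α A B) :=
  have ⟨E, hE⟩ := exists_isQEq (app (lam i α B) A) (subst i α A B)
  ⟨E, hE, beta_thm hA hf hE⟩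

theorem QE.repl_thm {α : Ty} {A B : Wff C α} (h : QE A B) {K D : Wff C .o}
    (hr : Repl (fun _ _ => True) A B K D) (hK : Thm K) : Thm D :=
  have ⟨_, hE, hT⟩ := h
  .r1 ⟨α, A, B, hE, hr⟩ hT hK

section Repl

variable {ok : ℕ → Ty → Prop} {α γ : Ty} {A B : Wff C α}

theorem Repl.ex_eq {K L : Wff C γ} {j : ℕ} (hj : ok j γ) (h : Repl ok A B K L) :
    Repl ok A B (ex j γ (eq (var j γ) K)) (ex j γ (eq (var j γ) L)) :=
  .appArg _ (.appArg _ (.lamBody _ _ hj (.appArg _ (.appArg _ h))))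

/-- `K` occurs twice in `K ≃ M`, in `K↓` and in the equation, so R1 is applied twice. -/
theorem QE.repl_qeq_left {K L M : Wff C γ} {j : ℕ} (h : QE A B)
    (hr : Repl (fun _ _ => True) A B K L) (hK : Thm (qeq j K M)) : Thm (qeq j L M) := by
  refine h.repl_thm ?_ (h.repl_thm (D := imp (or (ex j γ (eq (var j γ) L))
    (ex j γ (eq (var j γ) M))) (eq K M)) ?_ hK)
  · exact .appArg _ (.appFun _ (.appArg _ hr))
  · exact .appFun _ (.appArg _ (.appFun _ (.appArg _ (hr.ex_eq trivial))))

theorem QE.repl_qeq_right {K L M : Wff C γ} {j : ℕ} (h : QE A B)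
    (hr : Repl (fun _ _ => True) A B K L) (hK : Thm (qeq j M K)) : Thm (qeq j M L) := by
  refine h.repl_thm ?_ (h.repl_thm (D := imp (or (ex j γ (eq (var j γ) M))
    (ex j γ (eq (var j γ) L))) (eq M K)) ?_ hK)
  · exact .appArg _ (.appArg _ hr)
  · exact .appFun _ (.appArg _ (.appArg _ (hr.ex_eq trivial)))

end Repl

/-- For a fresh variable `z` of type `o`, A4 gives `[λ z A] z ≃ A`; rewriting the left side by this
same quasi-equality leaves `A ≃ A`. -/
theorem thm_qeq_self {α : Ty} {A : Wff C α} {j : ℕ} (hj : ¬ A.Occurs j α) :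
    Thm (qeq j A A) := by
  obtain ⟨N, hN⟩ := A.exists_forall_not_occurs
  let i := max N (j + 1)
  have hi : ¬ A.Free i .o := fun h => hN i (le_max_left _ _) _ h.occurs
  have hs : subst i .o (var i .o) A = A := subst_of_not_free hi
  have hb := QE.beta (B := A) (dfd_var i .o) (freeFor_of_not_free hi)
  have hij : j ≠ i := by have := le_max_right N (j + 1); omega
  have h1 : Thm (qeq j (app (lam i .o A) (var i .o)) (subst i .o (var i .o) A)) :=
    beta_thm (dfd_var i .o) (freeFor_of_not_free hi) (isQEq_qeq (by simp [Occurs, hij, hj])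
      (by rwa [hs]))
  rw [hs] at h1 hb
  exact hb.repl_qeq_left .here h1

namespace QE

variable {α β : Ty} {A B D : Wff C α}

theorem refl (A : Wff C α) : QE A A :=
  have ⟨N, hN⟩ := A.exists_forall_not_occurs
  ⟨_, isQEq_qeq (hN N le_rfl α) (hN N le_rfl α), thm_qeq_self (hN N le_rfl α)⟩

theorem of_repl (h : QE A B) {K L : Wff C β} (hr : Repl (fun _ _ => True) A B K L) : QE K L := by
  obtain ⟨N, hN⟩ := K.exists_forall_not_occurs
  obtain ⟨M, hM⟩ := L.exists_forall_not_occurs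
  have hK := hN (max N M) (le_max_left _ _) β
  have hL := hM (max N M) (le_max_right _ _) β
  exact ⟨_, isQEq_qeq hK hL, h.repl_qeq_right hr (thm_qeq_self hK)⟩

theorem symm (h : QE A B) : QE B A := by
  obtain ⟨N, hN⟩ := A.exists_forall_not_occurs
  obtain ⟨M, hM⟩ := B.exists_forall_not_occurs
  have hA := hN (max N M) (le_max_left _ _) α
  have hB := hM (max N M) (le_max_right _ _) α
  exact ⟨_, isQEq_qeq hB hA, h.repl_qeq_left .here (thm_qeq_self hA)⟩

theorem trans (h : QE A B) (h' : QE B D) : QE A D := by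
  obtain ⟨N, hN⟩ := A.exists_forall_not_occurs
  obtain ⟨M, hM⟩ := D.exists_forall_not_occurs
  have hA := hN (max N M) (le_max_left _ _) α
  have hD := hM (max N M) (le_max_right _ _) α
  exact ⟨_, isQEq_qeq hA hD,
    h'.repl_qeq_right .here (h.repl_qeq_right .here (thm_qeq_self hA))⟩

theorem app {F G : Wff C (.fn α β)} {A B : Wff C β} (h : QE F G) (h' : QE A B) :
    QE (app F A) (app G B) :=
  (h.of_repl (.appFun _ .here)).trans (h'.of_repl (.appArg _ .here))

theorem lam (i : ℕ) (β : Ty) (h : QE A B) : QE (lam i β A) (lam i β B) :=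
  h.of_repl (.lamBody _ _ trivial .here)

theorem eq {A' B' : Wff C α} (h : QE A A') (h' : QE B B') : QE (eq A B) (eq A' B') :=
  ((refl _).app h).app h'

theorem and {A B A' B' : Wff C .o} (h : QE A A') (h' : QE B B') : QE (and A B) (and A' B') :=
  ((refl _).app h).app h'

theorem imp {A B A' B' : Wff C .o} (h : QE A A') (h' : QE B B') : QE (imp A B) (imp A' B') :=
  ((refl _).app h).app h'

theorem or {A B A' B' : Wff C .o} (h : QE A A') (h' : QE B B') : QE (or A B) (or A' B') :=
  ((refl _).app h).app h'

theorem not {A A' : Wff C .o} (h : QE A A') : QE (not A) (not A') :=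
  (refl _).app h

theorem all (i : ℕ) (α : Ty) {A A' : Wff C .o} (h : QE A A') : QE (all i α A) (all i α A') :=
  (refl _).eq (h.lam i α)

theorem ex (i : ℕ) (α : Ty) {A A' : Wff C .o} (h : QE A A') : QE (ex i α A) (ex i α A') :=
  (h.not.all i α).not

theorem qeq (j : ℕ) {A' B' : Wff C α} (h : QE A A') (h' : QE B B') :
    QE (qeq j A B) (qeq j A' B') :=
  (or (ex j α ((refl _).eq h)) (ex j α ((refl _).eq h'))).imp (h.eq h')

theorem thm {A B : Wff C .o} (h : QE A B) (hA : Thm A) : Thm B := h.repl_thm .here hA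

/-- A11 after two detachments. Its conclusion is again a quasi-equality, so `≃` and `=` can be
exchanged inside any context. -/
theorem qeq_eq {G : Wff C .o} (hA : Dfd A) (hB : Dfd B) (hG : IsQEq A B G) :
    QE G (Wff.eq A B) := by
  obtain ⟨D, hD, hD'⟩ := hA
  obtain ⟨E, hE, hE'⟩ := hB
  obtain ⟨K, hK⟩ := exists_isQEq G (Wff.eq A B)
  exact ⟨K, hK, .r2 hE' (.r2 hD' (.ax (.A11 A B hD hE hG hK)))⟩

theorem thm_eq (h : QE A B) (hA : Dfd A) (hB : Dfd B) : Thm (Wff.eq A B) :=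
  have ⟨_, hG, hT⟩ := h
  (qeq_eq hA hB hG).thm hT

theorem of_thm_eq (h : Thm (Wff.eq A B)) (hA : Dfd A) (hB : Dfd B) : QE A B :=
  have ⟨G, hG⟩ := exists_isQEq A B
  ⟨G, hG, (qeq_eq hA hB hG).symm.thm h⟩

theorem subst {i : ℕ} {B D : Wff C β} (h : QE B D) {A : Wff C α} (hA : Dfd A)
    (hB : FreeFor i α A B) (hD : FreeFor i α A D) :
    QE (subst i α A B) (subst i α A D) :=
  (beta hA hB).symm.trans (((h.lam i α).app (refl A)).trans (beta hA hD))

end QE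

/-! ### Extensionality and the first truth values -/

theorem QE.ext {α β : Ty} {F G : Wff C (.fn α β)} (hF : Dfd F) (hG : Dfd G)
    (hFg : ¬ F.Free vg (.fn α β)) (hFx : ¬ F.Free vx β) (hGx : ¬ G.Free vx β)
    (hFj : ¬ F.Free 10 α) (hGj : ¬ G.Free 10 α) :
    QE (Wff.eq F G) (Wff.all vx β (Q0u.qeq 10 (Wff.app F (var vx β)) (Wff.app G (var vx β)))) := by
  -- The auxiliary variable only has to avoid `f`, `g` and `x`; fixing index 10 makes the right-hand
  -- side explicit.
  have h0 : QE (C := C) _ _ := .of_thm_eq (.ax (.A3 α β (isQEq_qeq (j := 10)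
    (by simp [Occurs]) (by simp [Occurs])))) (dfd_o _) (dfd_o _)
  have h1 := h0.subst (i := vf) hF (by simp)
    (by simp [Wff.all, Q0u.qeq, Wff.ex, freeFor_lam, hFx, hFj])
  -- `F` has already replaced `f` when `G` is substituted for `g`, so `F` must not contain `g`.
  have hs : Wff.subst vg (.fn α β) G F = F := subst_of_not_free hFg
  have hf : FreeFor vg (.fn α β) G F := freeFor_of_not_free hFg
  have h2 := h1.subst (i := vg) hG (by rw [Wff.subst_eq, subst_var_self]; simp [Wff.subst, hf])
    (by simp [Wff.all, Q0u.qeq, Wff.ex, freeFor_lam, Wff.subst, hGx, hGj, hf])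
  simpa [Wff.all, Q0u.qeq, Wff.ex, Wff.subst, hs] using h2

/-- By extensionality and a β-step, `f = f` and `f = λ k [f k]` are both quasi-equal to `∀ x [f x ≃
f x]`, and the first is a theorem. -/
theorem QE.eta_var (α β : Ty) {k : ℕ} (hk : k ≠ vf) :
    QE (var vf (.fn α β) : Wff C _) (Wff.lam k β (Wff.app (var vf (.fn α β)) (var k β))) := by
  have h1 : QE (C := C) (Wff.eq (var vf (.fn α β)) (var vf (.fn α β))) _ :=
    QE.ext (F := var vf (.fn α β)) (G := var vf (.fn α β)) (dfd_var _ _) (dfd_var _ _)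
      (by simp [Free]) (by simp [Free]) (by simp [Free])
      (by simp [Free]) (by simp [Free])
  have h2 : QE (C := C) (Wff.eq (var vf (.fn α β))
      (Wff.lam k β (Wff.app (var vf (.fn α β)) (var k β)))) _ :=
    QE.ext (F := var vf (.fn α β)) (G := Wff.lam k β (Wff.app (var vf (.fn α β)) (var k β)))
      (dfd_var _ _) (dfd_lam _ _ _) (by simp [Free]) (by simp [Free])
      (by simp +contextual [Free]) (by simp [Free]) (by simp +contextual [Free])
  have hb : QE (C := C) _ _ := QE.beta (i := k) (A := var vx β)
    (B := Wff.app (var vf (.fn α β)) (var k β)) (dfd_var _ _) (by simp)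
  simp only [Wff.subst_app, subst_var_self] at hb
  rw [subst_of_not_free (by simp [Free, hk])] at hb
  have h3 := h2.trans (((QE.refl _).qeq 10 hb).all vx β)
  exact .of_thm_eq ((h1.trans h3.symm).thm ((QE.refl _).thm_eq (dfd_var _ _) (dfd_var _ _)))
    (dfd_var _ _) (dfd_lam _ _ _)

/-- Substituting into the variable case avoids the freshness conditions that `QE.ext` would impose
on `G`. -/
theorem QE.eta {α β : Ty} {G : Wff C (.fn α β)} (hG : Dfd G) {k : ℕ} (hk : k ≠ vf)
    (hGk : ¬ G.Free k β) : QE G (Wff.lam k β (Wff.app G (var k β))) := by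
  have hk' : vf ≠ k := hk.symm
  have h := (QE.eta_var (C := C) α β hk).subst (i := vf) hG (by simp) (by simp [FreeFor, hGk])
  simpa [Wff.subst, hk', hk] using h

theorem QE.lam_closed {α β : Ty} {B : Wff C β} (hB : B.Closed) (i : ℕ) {k : ℕ} (hk : k ≠ vf) :
    QE (Wff.lam i α B) (Wff.lam k α B) := by
  have h := QE.beta (i := i) (A := var k α) (B := B) (dfd_var _ _)
    (freeFor_of_not_free (hB _ _))
  rw [subst_of_not_free (hB _ _)] at h
  exact (QE.eta (dfd_lam i α B) hk fun h => hB _ _ h.2).trans (h.lam _ _)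

theorem QE.beta_closed {α β : Ty} {A : Wff C α} {B : Wff C β} (hA : Dfd A) (hB : B.Closed)
    (i : ℕ) : QE (Wff.app (Wff.lam i α B) A) B := by
  have h := QE.beta (i := i) hA (freeFor_of_not_free (B := B) (hB _ _))
  rwa [subst_of_not_free (hB _ _)] at h

/-- Instantiation of a provable `[λ y T] ≃ [λ x B]`. -/
theorem QE.inst_lam {α : Ty} {i k : ℕ} {B : Wff C .o}
    (h : QE (Wff.lam k α tru) (Wff.lam i α B)) {A : Wff C α} (hA : Dfd A)
    (hf : FreeFor i α A B) : QE (Wff.subst i α A B) tru :=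
  (QE.beta hA hf).symm.trans ((h.symm.app (.refl A)).trans (.beta_closed hA closed_tru k))

theorem thm_tru : Thm (tru : Wff C .o) := (QE.refl _).thm_eq (dfd_Q _) (dfd_Q _)

theorem QE.thm_of_tru {A : Wff C .o} (h : QE A tru) : Thm A := h.symm.thm thm_tru

/-- That `A = A` is a theorem does not yet make it quasi-equal to `T`. Extensionality turns
reflexivity of the identity function into `∀ x [x = x]`, which unfolds to `λ y T = λ x [x = x]` and
is then applied to `A`. -/
theorem QE.eq_self {α : Ty} {A : Wff C α} (hA : Dfd A) : QE (Wff.eq A A) tru := by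
  have h1 : QE (C := C) (Wff.eq (Wff.lam vy α (var vy α)) (Wff.lam vy α (var vy α))) _ :=
    QE.ext (F := Wff.lam vy α (var vy α)) (G := Wff.lam vy α (var vy α)) (dfd_lam _ _ _)
      (dfd_lam _ _ _) (by simp +contextual [Free])
      (by simp +contextual [Free]) (by simp +contextual [Free]) (by simp +contextual [Free])
      (by simp +contextual [Free])
  have hb : QE (C := C) _ _ := QE.beta (i := vy) (A := var vx α) (B := var vy α) (dfd_var _ _)
    (by simp)
  rw [subst_var_self] at hb
  have h2 := h1.trans (((hb.qeq 10 hb).trans (QE.qeq_eq (dfd_var _ _) (dfd_var _ _)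
    (isQEq_qeq (by simp [Occurs]) (by simp [Occurs])))).all vx α)
  have h3 := h2.thm ((QE.refl _).thm_eq (dfd_lam _ _ _) (dfd_lam _ _ _))
  have h4 := (QE.of_thm_eq h3 (dfd_lam _ _ _) (dfd_lam _ _ _)).inst_lam hA (by simp)
  simpa using h4

theorem QE.eq_tru {α : Ty} {A B : Wff C α} (h : QE A B) (hA : Dfd A) : QE (Wff.eq A B) tru :=
  ((QE.refl A).eq h.symm).trans (.eq_self hA)

/-- Closedness rules out capture by the bound variables of the connective; the case of `T` and `F`
is all that the truth tables need. -/
theorem QE.and_closed {A B : Wff C .o} (hA : A.Closed) (hB : B.Closed) :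
    QE (Wff.and A B) (Wff.eq
      (Wff.lam vg (.fn (.fn .o .o) .o)
        (Wff.app (Wff.app (var vg (.fn (.fn .o .o) .o)) tru) tru))
      (Wff.lam vg (.fn (.fn .o .o) .o)
        (Wff.app (Wff.app (var vg (.fn (.fn .o .o) .o)) A) B))) := by
  have h1 := (QE.beta (i := vx) (dfd_o A) (hA.freeFor _)).app (.refl B) (F := andC.app A) |>.trans
    (QE.beta (i := vy) (dfd_o B) (hB.freeFor _))
  simpa [Wff.subst, subst_of_not_free (hA _ _), Wff.and] using h1

theorem QE.imp_closed {A B : Wff C .o} (hA : A.Closed) (hB : B.Closed) :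
    QE (Wff.imp A B) (Wff.eq A (Wff.and A B)) := by
  have h1 := (QE.beta (i := vx) (dfd_o A) (hA.freeFor _)).app (.refl B) (F := impC.app A) |>.trans
    (QE.beta (i := vy) (dfd_o B) (hB.freeFor _))
  simpa [Wff.subst, subst_of_not_free (hA _ _), Wff.imp] using h1

theorem QE.or_closed {A B : Wff C .o} (hA : A.Closed) (hB : B.Closed) :
    QE (Wff.or A B) (Wff.not (Wff.and (Wff.not A) (Wff.not B))) := by
  have h1 := (QE.beta (i := vx) (dfd_o A) (hA.freeFor _)).app (.refl B) (F := orC.app A) |>.trans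
    (QE.beta (i := vy) (dfd_o B) (hB.freeFor _))
  simpa [Wff.subst, subst_of_not_free (hA _ _), Wff.or] using h1

theorem QE.tru_and_tru : QE (Wff.and tru tru : Wff C .o) tru :=
  (QE.and_closed closed_tru closed_tru).trans (.eq_self (dfd_lam _ _ _))

/-- Contracting `λ x [g x]` to `g` in A1 before substituting removes the binder that could capture a
variable of `G`. -/
theorem QE.and_app_tru_fls {G : Wff C (.fn .o .o)} (hG : Dfd G) :
    QE (Wff.and (Wff.app G tru) (Wff.app G fls)) (Wff.eq (Wff.lam vy .o tru) G) := by
  have h0 : QE (C := C) _ _ := .of_thm_eq (.ax .A1) (dfd_o _) (dfd_o _)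
  have h1 := h0.trans ((QE.refl _).eq (QE.eta (k := vx) (dfd_var vg (.fn .o .o)) (by simp)
    (by simp [Free])).symm)
  have h2 := h1.subst (i := vg) hG (by simp) (by simp)
  simpa [Wff.subst] using h2

/-! ### Proof by cases -/

/-- The two cases make the left side of A1 for `λ z B` quasi-equal to `T ∧ T`, hence to `T`. So `λ y
T = λ z B` is a theorem, to be applied to `A`. -/
theorem QE.cases_tru {i : ℕ} {B : Wff C .o} (hT : QE (Wff.subst i .o tru B) tru)
    (hF : QE (Wff.subst i .o fls B) tru) {A : Wff C .o} (hA : FreeFor i .o A B) :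
    QE (Wff.subst i .o A B) tru := by
  have h1 := (QE.beta (dfd_o tru) (closed_tru.freeFor _)).trans hT
  have h2 := (QE.beta (dfd_o fls) (closed_fls.freeFor _)).trans hF
  have h3 := ((h1.and h2).trans .tru_and_tru).symm.trans (QE.and_app_tru_fls (dfd_lam i .o B))
  exact (QE.of_thm_eq (h3.thm thm_tru) (dfd_lam _ _ _) (dfd_lam _ _ _)).inst_lam (dfd_o A) hA

theorem QE.cases {i : ℕ} {B D : Wff C .o}
    (hT : QE (Wff.subst i .o tru B) (Wff.subst i .o tru D))
    (hF : QE (Wff.subst i .o fls B) (Wff.subst i .o fls D)) {A : Wff C .o}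
    (hB : FreeFor i .o A B) (hD : FreeFor i .o A D) :
    QE (Wff.subst i .o A B) (Wff.subst i .o A D) :=
  .of_thm_eq (QE.cases_tru (B := Wff.eq B D) (hT.eq_tru (dfd_o _)) (hF.eq_tru (dfd_o _))
    (by simp [hB, hD])).thm_of_tru (dfd_o _) (dfd_o _)

theorem QE.fls_all : QE (fls : Wff C .o) (Wff.all vx .o (var vx .o)) :=
  (QE.lam_closed closed_tru _ (k := vy) (by simp)).eq (.refl _)

/-- This is A1 for the identity function: `∀ x x` is `F` up to renaming a bound variable. -/
theorem QE.tru_and_fls : QE (Wff.and tru fls : Wff C .o) fls := by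
  have h (A : Wff C .o) : QE (Wff.app (Wff.lam vx .o (var vx .o)) A) A := by
    simpa using QE.beta (i := vx) (B := var vx .o) (dfd_o A) (by simp)
  exact ((h tru).and (h fls)).symm.trans
    ((QE.and_app_tru_fls (dfd_lam _ _ _)).trans QE.fls_all.symm)

theorem QE.tru_and (A : Wff C .o) : QE (Wff.and tru A) A := by
  simpa using QE.cases (i := vx) (B := Wff.and tru (var vx .o)) (D := var vx .o) (A := A)
    (by simpa using QE.tru_and_tru) (by simpa using QE.tru_and_fls) (by simp) (by simp)

/-- Both sides are quasi-equal to `∀ x [T = x]`: the left by A1, as `[T = T] ∧ [T = F]`; the right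
by extensionality, since `F` equates `λ x T` with `λ x x`. -/
theorem QE.tru_eq_fls : QE (Wff.eq tru fls : Wff C .o) fls := by
  have h (A : Wff C .o) :
      QE (Wff.app (Wff.lam vx .o (Wff.eq tru (var vx .o))) A) (Wff.eq tru A) := by
    simpa using QE.beta (i := vx) (B := Wff.eq tru (var vx .o)) (dfd_o A) (by simp)
  have h1 : QE (Wff.eq tru fls : Wff C .o) (Wff.all vx .o (Wff.eq tru (var vx .o))) :=
    (QE.tru_and _).symm.trans ((((h tru).trans (.eq_self (dfd_o _))).and (h fls)).symm.trans
      (QE.and_app_tru_fls (dfd_lam _ _ _)))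
  have h2 : QE (C := C) fls _ := QE.ext (dfd_lam _ _ _) (dfd_lam _ _ _)
    (fun h => closed_tru _ _ h.2) (by simp [Free]) (by simp [Free])
    (fun h => closed_tru _ _ h.2) (by simp +contextual [Free])
  have hb : QE (C := C) (Wff.app (Wff.lam vx .o (var vx .o)) (var vx .o)) (var vx .o) := by
    simpa using QE.beta (C := C) (i := vx) (B := var vx .o) (dfd_var vx .o) (by simp)
  have h3 := h2.trans ((((QE.beta_closed (dfd_var _ _) closed_tru _).qeq 10 hb).trans
    (QE.qeq_eq (dfd_o _) (dfd_o _) (isQEq_qeq (by simp [Occurs, tru, Wff.eq])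
      (by simp [Occurs])))).all vx .o)
  exact h1.trans h3.symm

theorem QE.tru_eq (A : Wff C .o) : QE (Wff.eq tru A) A := by
  simpa using QE.cases (i := vx) (B := Wff.eq tru (var vx .o)) (D := var vx .o) (A := A)
    (by simpa using QE.eq_self (dfd_o _)) (by simpa using QE.tru_eq_fls) (by simp) (by simp)

theorem Thm.qe_tru {A : Wff C .o} (h : Thm A) : QE A tru :=
  (QE.of_thm_eq ((QE.tru_eq A).symm.thm h) (dfd_o _) (dfd_o _)).symm

theorem Thm.subst {A : Wff C .o} (h : Thm A) {i : ℕ} {β : Ty} {B : Wff C β} (hB : Dfd B)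
    (hf : FreeFor i β B A) : Thm (subst i β B A) := by
  have h1 := h.qe_tru.subst (i := i) hB hf (by simp)
  rw [subst_tru] at h1
  exact h1.thm_of_tru

theorem Thm.cases {i : ℕ} {B : Wff C .o} (hT : Thm (Wff.subst i .o tru B))
    (hF : Thm (Wff.subst i .o fls B)) {A : Wff C .o} (hA : FreeFor i .o A B) :
    Thm (Wff.subst i .o A B) :=
  (QE.cases_tru hT.qe_tru hF.qe_tru hA).thm_of_tru

/-! ### Truth tables -/

/-- The Leibniz law for closed wffs. -/
theorem Thm.leibniz {α : Ty} {A B : Wff C α} (hA : Dfd A) (hB : Dfd B) (cA : A.Closed)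
    (cB : B.Closed) {G : Wff C (.fn .o α)} (hG : Dfd G) :
    Thm (imp (eq A B) (eq (app G A) (app G B))) := by
  have h1 := (Thm.ax (AxInst.A2 (C := C) α)).subst (i := vx) hA (by simp)
  have h2 := h1.subst (i := vy) hB (by simp [cB.freeFor])
  have h3 := h2.subst (i := vh) hG (by
    simp [Wff.subst, subst_of_not_free (cA _ _), freeFor_of_not_free (cA _ _),
      freeFor_of_not_free (cB _ _)])
  simpa [Wff.subst, subst_of_not_free (cA _ _), subst_of_not_free (cB _ _)] using h3

/-- `F` is the equation `λ x T = λ x x`, so Leibniz's law for `λ f [f A]` reads `F ⊃ [T = A]`, that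
is `F ⊃ A`, which unfolds to `F = [F ∧ A]`. -/
theorem QE.fls_and {A : Wff C .o} (hA : A.Closed) : QE (Wff.and fls A) fls := by
  have cT : (Wff.lam vx .o tru : Wff C _).Closed := fun _ _ h => closed_tru _ _ h.2
  have cI : (Wff.lam vx .o (var vx .o) : Wff C _).Closed := fun _ _ h => h.1 h.2
  have h1 := Thm.leibniz (C := C) (dfd_lam vx .o tru) (dfd_lam vx .o (var vx .o)) cT cI
    (dfd_lam vf (.fn .o .o) (Wff.app (var vf (.fn .o .o)) A))
  have hb (G : Wff C (.fn .o .o)) (hG : Dfd G) :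
      QE (Wff.app (Wff.lam vf (.fn .o .o) (Wff.app (var vf (.fn .o .o)) A)) G)
        (Wff.app G A) := by
    simpa [subst_of_not_free (hA _ _)] using
      QE.beta (i := vf) (B := Wff.app (var vf (.fn .o .o)) A) hG
        (by simp [freeFor_of_not_free (hA _ _)])
  have hI : QE (Wff.app (Wff.lam vx .o (var vx .o)) A) A := by
    simpa using QE.beta (i := vx) (B := var vx .o) (dfd_o A) (by simp)
  have h2 := ((QE.refl (fls : Wff C .o)).imp
    (((hb _ (dfd_lam _ _ _)).trans (.beta_closed (dfd_o A) closed_tru _)).eq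
      ((hb _ (dfd_lam _ _ _)).trans hI))).thm h1
  have h3 := (((QE.refl _).imp (QE.tru_eq A)).trans (.imp_closed closed_fls hA)).thm h2
  exact (QE.of_thm_eq h3 (dfd_o _) (dfd_o _)).symm

theorem QE.and_fls (A : Wff C .o) : QE (Wff.and A fls) fls := by
  simpa using QE.cases (i := vx) (B := Wff.and (var vx .o) fls) (D := fls) (A := A)
    (by simpa using QE.tru_and_fls) (by simpa using QE.fls_and closed_fls) (by simp) (by simp)

/-- Leibniz's law for `λ x [x = F]` reduces to `[F = T] ⊃ F`, which unfolds to `[F = T] = [[F = T] ∧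
F]`. -/
theorem QE.fls_eq_tru : QE (Wff.eq fls tru : Wff C .o) fls := by
  have h1 := Thm.leibniz (C := C) (dfd_o fls) (dfd_o tru) closed_fls closed_tru
    (dfd_lam vx .o (Wff.eq (var vx .o) fls))
  have hb (A : Wff C .o) :
      QE (Wff.app (Wff.lam vx .o (Wff.eq (var vx .o) fls)) A) (Wff.eq A fls) := by
    simpa using QE.beta (i := vx) (B := Wff.eq (var vx .o) fls) (dfd_o A) (by simp)
  have c : (Wff.eq fls tru : Wff C .o).Closed := by
    intro i β h
    rcases h with (h | h) | h
    · exact h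
    · exact closed_fls _ _ h
    · exact closed_tru _ _ h
  have h2 := ((QE.refl (Wff.eq fls tru : Wff C .o)).imp
    ((((hb fls).trans (.eq_self (dfd_o _))).eq ((hb tru).trans .tru_eq_fls)).trans
      .tru_eq_fls)).trans (.imp_closed c closed_fls) |>.thm h1
  exact (QE.of_thm_eq h2 (dfd_o _) (dfd_o _)).trans (.and_fls _)

/-- The wff `T_o` or `F_o` denoting a truth value. -/
def Wff.ofBool (b : Bool) : Wff C .o := if b then tru else fls

theorem Wff.closed_ofBool (b : Bool) : (ofBool b : Wff C .o).Closed := by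
  cases b
  · exact closed_fls
  · exact closed_tru

theorem QE.eq_ofBool (a b : Bool) :
    QE (Wff.eq (ofBool a) (ofBool b) : Wff C .o) (ofBool (a == b)) := by
  cases a <;> cases b
  · exact .eq_self (dfd_o _)
  · exact .fls_eq_tru
  · exact .tru_eq_fls
  · exact .eq_self (dfd_o _)

theorem QE.not_ofBool (a : Bool) : QE (Wff.not (ofBool a) : Wff C .o) (ofBool !a) := by
  -- `∼A` is literally `F = A`.
  have h := QE.eq_ofBool (C := C) false a
  cases a <;> exact h

theorem QE.and_ofBool (a b : Bool) :
    QE (Wff.and (ofBool a) (ofBool b) : Wff C .o) (ofBool (a && b)) := by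
  cases a
  · exact .fls_and (closed_ofBool b)
  · exact .tru_and _

theorem QE.imp_ofBool (a b : Bool) :
    QE (Wff.imp (ofBool a) (ofBool b) : Wff C .o) (ofBool (!a || b)) := by
  have h := (QE.imp_closed (C := C) (closed_ofBool a) (closed_ofBool b)).trans
    (((QE.refl _).eq (.and_ofBool a b)).trans (.eq_ofBool _ _))
  cases a <;> cases b <;> exact h

theorem QE.or_ofBool (a b : Bool) :
    QE (Wff.or (ofBool a) (ofBool b) : Wff C .o) (ofBool (a || b)) := by
  have h := (QE.or_closed (C := C) (closed_ofBool a) (closed_ofBool b)).trans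
    ((((QE.not_ofBool a).and (.not_ofBool b)).trans (.and_ofBool _ _)).not.trans
      (.not_ofBool _))
  cases a <;> cases b <;> exact h

/-! ### Tautologies -/

namespace PropForm

theorem inst_ofBool (v : ℕ → Bool) (p : PropForm) :
    QE (p.inst fun n => (ofBool (v n) : Wff C .o)) (ofBool (p.eval v)) := by
  induction p with
  | atom n => exact .refl _
  | tru => exact .refl _
  | fls => exact .refl _
  | neg p hp => exact hp.not.trans (.not_ofBool _)
  | conj p q hp hq => exact (hp.and hq).trans (.and_ofBool _ _)
  | disj p q hp hq => exact (hp.or hq).trans (.or_ofBool _ _)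
  | imp p q hp hq => exact (hp.imp hq).trans (.imp_ofBool _ _)
  | iff p q hp hq => exact (hp.eq hq).trans (.eq_ofBool _ _)

theorem subst_inst (i : ℕ) {β : Ty} (A : Wff C β) (σ : ℕ → Wff C .o) (p : PropForm) :
    subst i β A (p.inst σ) = p.inst fun n => subst i β A (σ n) := by
  induction p <;> simp_all [inst]

theorem freeFor_inst {i : ℕ} {β : Ty} {A : Wff C β} {σ : ℕ → Wff C .o}
    (h : ∀ n, FreeFor i β A (σ n)) (p : PropForm) : FreeFor i β A (p.inst σ) := by
  induction p <;> simp_all [inst]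

theorem exists_inst_congr (p : PropForm) : ∃ N, ∀ σ τ : ℕ → Wff C .o,
    (∀ n < N, σ n = τ n) → p.inst σ = p.inst τ := by
  have two {p q : PropForm} (hp : ∃ N, ∀ σ τ : ℕ → Wff C .o, (∀ n < N, σ n = τ n) →
      p.inst σ = p.inst τ) (hq : ∃ N, ∀ σ τ : ℕ → Wff C .o, (∀ n < N, σ n = τ n) →
      q.inst σ = q.inst τ) : ∃ N, ∀ σ τ : ℕ → Wff C .o, (∀ n < N, σ n = τ n) →
      p.inst σ = p.inst τ ∧ q.inst σ = q.inst τ := by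
    obtain ⟨N, hN⟩ := hp
    obtain ⟨M, hM⟩ := hq
    exact ⟨max N M, fun σ τ h => ⟨hN σ τ fun n hn => h n (lt_max_of_lt_left hn),
      hM σ τ fun n hn => h n (lt_max_of_lt_right hn)⟩⟩
  induction p with
  | atom n => exact ⟨n + 1, fun σ τ h => h n n.lt_succ_self⟩
  | tru => exact ⟨0, fun σ τ h => rfl⟩
  | fls => exact ⟨0, fun σ τ h => rfl⟩
  | neg p hp =>
    obtain ⟨N, hN⟩ := hp
    exact ⟨N, fun σ τ h => congrArg Wff.not (hN σ τ h)⟩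
  | conj p q hp hq =>
    obtain ⟨N, hN⟩ := two hp hq
    exact ⟨N, fun σ τ h => by simp [inst, hN σ τ h]⟩
  | disj p q hp hq =>
    obtain ⟨N, hN⟩ := two hp hq
    exact ⟨N, fun σ τ h => by simp [inst, hN σ τ h]⟩
  | imp p q hp hq =>
    obtain ⟨N, hN⟩ := two hp hq
    exact ⟨N, fun σ τ h => by simp [inst, hN σ τ h]⟩
  | iff p q hp hq =>
    obtain ⟨N, hN⟩ := two hp hq
    exact ⟨N, fun σ τ h => by simp [inst, hN σ τ h]⟩

/-- Only finitely many values of `σ` can be avoided at once: all of them together may use every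
variable. -/
theorem exists_fresh (σ : ℕ → Wff C .o) (k : ℕ) :
    ∃ N, ∀ n < k, ¬ (σ n).Free N .o := by
  suffices h : ∃ N, ∀ j, N ≤ j → ∀ n < k, ¬ (σ n).Free j .o from
    ⟨h.choose, h.choose_spec _ le_rfl⟩
  induction k with
  | zero => exact ⟨0, by simp⟩
  | succ k ih =>
    obtain ⟨N, hN⟩ := ih
    obtain ⟨M, hM⟩ := (σ k).exists_forall_not_occurs
    refine ⟨max N M, fun j hj n hn => ?_⟩
    rcases Nat.lt_succ_iff_lt_or_eq.1 hn with hn | rfl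
    · exact hN j (le_trans (le_max_left _ _) hj) n hn
    · exact fun h => hM j (le_trans (le_max_right _ _) hj) _ h.occurs

/-- Induction on the number of atoms already replaced. A variable `z` not free in the earlier wffs
is put at atom `k`; both cases for `z` are instances of the induction hypothesis, and `σ k` may then
be substituted for `z`. -/
theorem IsTautology.thm_inst_ite {p : PropForm} (hp : p.IsTautology) (σ : ℕ → Wff C .o) (k : ℕ) :
    ∀ v : ℕ → Bool, Thm (p.inst fun n => if n < k then σ n else ofBool (v n)) := by
  induction k with
  | zero =>
    intro v
    have h := inst_ofBool (C := C) v p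
    rw [hp v] at h
    simpa using h.thm_of_tru
  | succ k ih =>
    intro v
    obtain ⟨z, hz⟩ := exists_fresh σ k
    let τ : ℕ → Wff C .o := fun n =>
      if n < k then σ n else if n = k then var z .o else ofBool (v n)
    have hτ (A : Wff C .o) : subst z .o A (p.inst τ) = p.inst fun n =>
        if n < k then σ n else if n = k then A else ofBool (v n) := by
      rw [subst_inst]
      congr 1
      funext n
      by_cases h1 : n < k
      · simp [τ, h1, subst_of_not_free (hz n h1)]
      · by_cases h2 : n = k
        · simp [τ, h2]
        · simp [τ, h1, h2, subst_of_not_free (closed_ofBool _ _ _)]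
    have hb (b : Bool) : Thm (subst z .o (ofBool b) (p.inst τ)) := by
      rw [hτ]
      -- Having the constant `b` at atom `k` amounts to changing the assignment there, which is why
      -- the induction quantifies over all `v`.
      convert ih (Function.update v k b) using 3 with n
      by_cases h2 : n = k <;> simp [h2]
    have h := Thm.cases (A := σ k) (hb true) (hb false) (freeFor_inst (fun n => by
      by_cases h1 : n < k
      · simp [τ, h1, freeFor_of_not_free (hz n h1)]
      · by_cases h2 : n = k
        · simp [τ, h2]
        · simp [τ, h1, h2, freeFor_of_not_free (closed_ofBool _ _ _)]) p)
    rw [hτ] at h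
    convert h using 3 with n
    by_cases h1 : n < k
    · simp [h1, Nat.lt_succ_of_lt h1]
    · by_cases h2 : n = k
      · simp [h2]
      · have h3 : ¬ n < k + 1 := by omega
        simp [h1, h2, h3]

theorem IsTautology.thm_inst {p : PropForm} (hp : p.IsTautology) (σ : ℕ → Wff C .o) :
    Thm (p.inst σ) := by
  obtain ⟨N, hN⟩ := p.exists_inst_congr (C := C)
  rw [hN σ (fun n => if n < N then σ n else ofBool true) fun n hn => by simp [hn]]
  exact hp.thm_inst_ite σ N _

end PropForm

theorem Tautologous.thm {B : Wff C .o} (h : Tautologous B) : Thm B := by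
  obtain ⟨p, σ, hp, rfl⟩ := h
  exact hp.thm_inst σ

theorem thm_imp_imp_and (A B : Wff C .o) : Thm (imp A (imp B (and A B))) := by
  refine Tautologous.thm ⟨.imp (.atom 0) (.imp (.atom 1) (.conj (.atom 0) (.atom 1))),
    fun n => if n = 0 then A else B, fun v => ?_, by simp [PropForm.inst]⟩
  cases h0 : v 0 <;> cases h1 : v 1 <;> simp [PropForm.eval, h0, h1]

theorem Proves.bigAnd {H : Set (Wff C .o)} : ∀ (n : ℕ) (A : Fin (n + 1) → Wff C .o),
    (∀ k, Proves H (A k)) → Proves H (bigAnd n A)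
  | 0, _, h => h 0
  | n + 1, _, h =>
    (h (Fin.last (n + 1))).mp ((Proves.bigAnd n _ fun k => h k.castSucc).mp
      ((thm_imp_imp_and _ _).proves H))

end Q0u

theorem mainTheorem5 {C : Q0u.Ty → Type*} (H : Set (Q0u.Wff C Q0u.Ty.o))
    (B : Q0u.Wff C Q0u.Ty.o) :
    (∀ (n : ℕ) (A : Fin (n + 1) → Q0u.Wff C Q0u.Ty.o),
      (∀ k, Q0u.Proves H (A k)) →
      Q0u.Tautologous (Q0u.Wff.imp (Q0u.bigAnd n A) B) →
      Q0u.Proves H B) ∧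
    (Q0u.Tautologous B → Q0u.Proves H B) :=
  ⟨fun n A hA h => (Q0u.Proves.bigAnd n A hA).mp (h.thm.proves H), fun h => h.thm.proves H⟩
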